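/- For $I\in\mathbb R^n$ and $r>0$ let $B^n(I,r)$ be the open Euclidean ball of radius $r$ around $I$, and let $\|\cdot\|$ be the Euclidean norm. **Definition (steepness).** Let $I_0\in\mathbb R^n$, $R>0$, $\delta>0$. A $C^2$ function $h:B^n(I_0,R+2\delta)\to\mathbb R$ is *steep* in $B^n(I_0,R)$ with steepness indices $\alpha_1,\dots,\alpha_{n-1}\ge 1$ and steepness coefficients $C_1,\dots,C_{n-1}>0$ and $\delta$ if 1. $\inf_{I\in B^n(I_0,R)}\|\nabla h(I)\|>0$, and 2. for every $I\in B^n(I_0,R)$, every integer $1\le m<n$ and every $m$-dimensional linear subspace $\Gamma\subset\mathbb R^n$ orthogonal to $\nabla h(I)$, $$\max_{0\le\eta\le\xi}\ \min_{u\in\Gamma,\ \|u\|=\eta}\ \|\pi_\Gamma\nabla h(I+u)\|>C_m\,\xi^{\alpha_m}\qquad\text{for all }\xi\in(0,\delta],$$ where $\pi_\Gamma$ is the orthogonal projection onto $\Gamma$. For a function $h$ of class $C^k$ near $I_0$, let $h^k_{I_0}[w,\dots,w]=\sum_{i_1,\dots,i_k=1}^n\frac{\partial^k h(I_0)}{\partial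 I_{i_1}\cdots\partial I_{i_k}}\,w_{i_1}\cdots w_{i_k}$ be its $k$-th differential at $I_0$ evaluated at $k$ copies of $w\in\mathbb R^n$. **Corollary B1.** Let $n\ge 2$ be an integer, let $I_0\in\mathbb R^n$, and let $h$ be a real function of class $C^5$ in a neighbourhood of $I_0$ with $\nabla h(I_0)\ne 0$. Suppose that $h$ is 3-jet nondegenerate at $I_0$, that is, there is no $w\in\mathbb R^n$ with $\|w\|=1$ and $$h^1_{I_0}[w]=h^2_{I_0}[w,w]=h^3_{I_0}[w,w,w]=0.$$ Then $h$ is steep in a neighbourhood of $I_0$, with first index $2$ and all other indices at most $3$: there exist $R>0$, $\delta>0$, $C_1,\dots,C_{n-1}>0$ and $\alpha_1,\dots,\alpha_{n-1}\ge 1$ with $\alpha_1=2$ and $\alpha_m\le 3$ for $2\le m\le n-1$ such that $h$ is of class $C^2$ on $B^n(I_0,R+2\delta)$ and is steep in $B^n(I_0,R)$ with steepness indices $\alpha_1,\dots,\alpha_{n-1}$ and steepness coefficients $C_1,\dots,C_{n-1},\delta$. -/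

import Mathlib

/-- `minProjGrad h I Γ η` is the minimum, over all `u ∈ Γ` with `‖u‖ = η`, of the norm of the
orthogonal projection on `Γ` of `∇ h (I + u)`. (The infimum of a set of nonnegative reals; it is
attained when `h` is of class `C¹` near the sphere in question, which is then compact and, for
`dim Γ ≥ 1` and `η ≥ 0`, nonempty.) -/
noncomputable def minProjGrad {n : ℕ} (h : EuclideanSpace ℝ (Fin n) → ℝ)
    (I : EuclideanSpace ℝ (Fin n)) (Γ : Submodule ℝ (EuclideanSpace ℝ (Fin n))) (η : ℝ) : ℝ :=
  sInf ((fun u : EuclideanSpace ℝ (Fin n) => ‖Γ.starProjection (gradient h (I + u))‖) ''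
    {u | u ∈ Γ ∧ ‖u‖ = η})

/-- `maxMinProjGrad h I Γ ξ` is the maximum of `minProjGrad h I Γ η` over `0 ≤ η ≤ ξ`. -/
noncomputable def maxMinProjGrad {n : ℕ} (h : EuclideanSpace ℝ (Fin n) → ℝ)
    (I : EuclideanSpace ℝ (Fin n)) (Γ : Submodule ℝ (EuclideanSpace ℝ (Fin n))) (ξ : ℝ) : ℝ :=
  sSup (minProjGrad h I Γ '' Set.Icc 0 ξ)

/-- `IsSteep h I₀ R α C δ`: the function `h`, of class `C²` on the ball of radius `R + 2δ` around
`I₀`, is steep in the ball of radius `R` around `I₀`, with steepness indices `α 1, …, α (n-1) ≥ 1`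
and positive steepness coefficients `C 1, …, C (n-1), δ`. Values of `h` outside the larger ball,
and values `α m`, `C m` for `m = 0` or `m ≥ n`, play no role. -/
structure IsSteep {n : ℕ} (h : EuclideanSpace ℝ (Fin n) → ℝ) (I₀ : EuclideanSpace ℝ (Fin n))
    (R : ℝ) (α C : ℕ → ℝ) (δ : ℝ) : Prop where
  radius_pos : 0 < R
  delta_pos : 0 < δ
  one_le_index : ∀ m : ℕ, 1 ≤ m → m < n → 1 ≤ α m
  coeff_pos : ∀ m : ℕ, 1 ≤ m → m < n → 0 < C m
  contDiffOn : ContDiffOn ℝ 2 h (Metric.ball I₀ (R + 2 * δ))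
  grad_inf_pos : 0 < sInf ((fun I => ‖gradient h I‖) '' Metric.ball I₀ R)
  steep : ∀ I ∈ Metric.ball I₀ R, ∀ m : ℕ, 1 ≤ m → m < n →
    ∀ Γ : Submodule ℝ (EuclideanSpace ℝ (Fin n)), Module.finrank ℝ Γ = m →
      (∀ u ∈ Γ, inner ℝ (gradient h I) u = 0) →
        ∀ ξ : ℝ, 0 < ξ → ξ ≤ δ → C m * ξ ^ α m < maxMinProjGrad h I Γ ξ

/-- `ThreeJetNondegenerate h I₀`: there is no unit vector `w` at which the first, second and third
order differentials of `h` at `I₀`, evaluated at `w`, `(w, w)`, `(w, w, w)`, all vanish. -/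
def ThreeJetNondegenerate {n : ℕ} (h : EuclideanSpace ℝ (Fin n) → ℝ)
    (I₀ : EuclideanSpace ℝ (Fin n)) : Prop :=
  ¬ ∃ w : EuclideanSpace ℝ (Fin n), ‖w‖ = 1 ∧
    iteratedFDeriv ℝ 1 h I₀ ![w] = 0 ∧
    iteratedFDeriv ℝ 2 h I₀ ![w, w] = 0 ∧
    iteratedFDeriv ℝ 3 h I₀ ![w, w, w] = 0

/-!
The index `2` works for subspaces `Γ` of every dimension.

For `Γ` orthogonal to `∇h(I)`, the projected gradient at `I + u`, `u ∈ Γ`, is the derivative of the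
restriction of `h` to `I + Γ`, up to duality, and by Taylor's formula it is
`D²h(I) u + ½ D³h(I₀) u u`, restricted to `Γ`, up to a small multiple of `‖u‖²`
(`exists_taylor_two_uniform`). Suppose it is much smaller than `ξ²` both at some `u` of norm `ξ`
and at some `v` of norm `ξ / 2`, and put `x = u / ξ`, `y = v / ξ`. Testing the two gradients
against `x` and `y` bounds `D²h(I) a b + (ξ / 2) D³h(I₀) a a b`, for `a` and `b` among `x` and `y`,
by a small multiple of `ξ`. Hence, as `I → I₀` and `ξ → 0` along a suitable sequence, `x → w` and
`y → z` with `‖w‖ = 1`, `‖z‖ = 1 / 2`, both annihilated by `Dh(I₀)` and spanning an isotropic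
subspace of `D²h(I₀)`. This subspace is a line, since the cubic form `D³h(I₀)`, being odd, vanishes
somewhere on the unit circle of a plane, against nondegeneracy (`exists_eq_smul_of_isotropic`). So
`z = s w` with `s = ±1 / 2`. Subtracting the bounds for `(a, b) = (x, y)` and `(y, x)` cancels the
symmetric second order terms, and division by `ξ` gives in the limit
`(s - s²) D³h(I₀) w w w = 0`, which again contradicts nondegeneracy
(`exists_pos_taylor_lower_bound`). The radii `ξ` and `ξ / 2` therefore cannot both be bad, and the
maximum over `η ≤ ξ` is at least a constant times `ξ²` (`exists_pos_projected_gradient`).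
-/

/-! ### Forms with no common isotropic vector -/

section Forms

open Filter Topology

variable {E : Type*} [NormedAddCommGroup E] [NormedSpace ℝ E]

/-- A common isotropic space of `G` and `H` is at most a line, because the cubic `T`, being odd,
vanishes somewhere on the circle in any plane. -/
lemma exists_eq_smul_of_isotropic {G : E →L[ℝ] ℝ} {H : E →L[ℝ] E →L[ℝ] ℝ}
    {T : E →L[ℝ] E →L[ℝ] E →L[ℝ] ℝ}
    (nondeg : ∀ w, w ≠ 0 → G w = 0 → H w w = 0 → T w w w ≠ 0) {w z : E} (hw : w ≠ 0)
    (Gw : G w = 0) (Gz : G z = 0) (Hww : H w w = 0) (Hwz : H w z = 0) (Hzw : H z w = 0)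
    (Hzz : H z z = 0) : ∃ s : ℝ, z = s • w := by
  by_contra! hne
  let c : ℝ → E := fun θ => Real.cos θ • w + Real.sin θ • z
  have hc : Continuous c := by fun_prop
  have hf : Continuous fun θ => T (c θ) (c θ) (c θ) := by fun_prop
  have hπ : T (c Real.pi) (c Real.pi) (c Real.pi) = -T (c 0) (c 0) (c 0) := by simp [c]
  obtain ⟨θ, hθ⟩ : (0 : ℝ) ∈ Set.range fun θ => T (c θ) (c θ) (c θ) := by
    rcases le_total (T (c 0) (c 0) (c 0)) 0 with h | h
    · exact mem_range_of_exists_le_of_exists_ge hf ⟨0, h⟩ ⟨Real.pi, by simp only [hπ]; linarith⟩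
    · exact mem_range_of_exists_le_of_exists_ge hf ⟨Real.pi, by simp only [hπ]; linarith⟩ ⟨0, h⟩
  refine nondeg (c θ) (fun h0 => ?_) (by simp [c, Gw, Gz]) (by simp [c, Hww, Hwz, Hzw, Hzz]) hθ
  by_cases hs : Real.sin θ = 0
  · have hcos : Real.cos θ ≠ 0 := fun hcos => by
      simpa [hs, hcos] using Real.sin_sq_add_cos_sq θ
    simp [c, hs, hcos, hw] at h0
  · refine hne (-(Real.sin θ)⁻¹ * Real.cos θ) ?_
    have h1 : Real.sin θ • z = -(Real.cos θ • w) := eq_neg_of_add_eq_zero_right h0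
    rw [← inv_smul_smul₀ hs z, h1, smul_neg, smul_smul, neg_mul, neg_smul]

lemma tendsto_clm_apply {F ι : Type*} [NormedAddCommGroup F] [NormedSpace ℝ F] {l : Filter ι}
    {A : ι → E →L[ℝ] F} {A₀ : E →L[ℝ] F} {a : ι → E} {α : E} (hA : Tendsto A l (𝓝 A₀))
    (ha : Tendsto a l (𝓝 α)) : Tendsto (fun k => A k (a k)) l (𝓝 (A₀ α)) :=
  (isBoundedBilinearMap_apply.continuous.tendsto (A₀, α)).comp (hA.prodMk_nhds ha)

lemma tendsto_clm_of_norm_sub_le {F ι : Type*} [NormedAddCommGroup F] [NormedSpace ℝ F]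
    {l : Filter ι} {A : ι → E →L[ℝ] F} {A₀ : E →L[ℝ] F} {e : ι → ℝ} (he : Tendsto e l (𝓝 0))
    (hA : ∀ k, ‖A k - A₀‖ ≤ e k) : Tendsto A l (𝓝 A₀) :=
  tendsto_iff_norm_sub_tendsto_zero.2 (squeeze_zero (fun _ => norm_nonneg _) hA he)

/-- The vectors `x` and `y` stand for displacements of lengths `ξ` and `ξ / 2`, divided by `ξ`, and
`ξ * (B a b + ξ / 2 * T a a b)` for the second order Taylor polynomial, at the displacement `ξ • a`,
of the derivative in the direction `b`. If the conclusion fails, `B x y / ξ` need not be small, but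
the symmetry `B x y = B y x` still makes `T x x y - T y y x` small. -/
lemma exists_pos_taylor_lower_bound [FiniteDimensional ℝ E] {G₀ : E →L[ℝ] ℝ}
    {H₀ : E →L[ℝ] E →L[ℝ] ℝ} {T : E →L[ℝ] E →L[ℝ] E →L[ℝ] ℝ}
    (nondeg : ∀ w, w ≠ 0 → G₀ w = 0 → H₀ w w = 0 → T w w w ≠ 0) :
    ∃ ε : ℝ, 0 < ε ∧ ∀ (G : E →L[ℝ] ℝ) (B : E →L[ℝ] E →L[ℝ] ℝ) (ξ : ℝ) (x y : E),
      ‖G - G₀‖ ≤ ε → ‖B - H₀‖ ≤ ε → 0 < ξ → ξ ≤ ε → ‖x‖ = 1 → ‖y‖ = 1 / 2 →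
      B x y = B y x → G x = 0 → G y = 0 →
      ∃ a ∈ ({x, y} : Set E), ∃ b ∈ ({x, y} : Set E), ε * ξ < |B a b + ξ / 2 * T a a b| := by
  by_contra! hcon
  choose G B ξ x y hG hB hξ0 hξ hx hy hsymm hGx hGy hbd using
    fun k : ℕ => hcon (1 / ((k : ℝ) + 1)) (by positivity)
  have hε : Tendsto (fun k : ℕ => 1 / ((k : ℝ) + 1)) atTop (𝓝 0) :=
    tendsto_one_div_add_atTop_nhds_zero_nat
  have hcpt : IsCompact (Metric.sphere (0 : E) 1 ×ˢ Metric.sphere (0 : E) (1 / 2)) :=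
    (isCompact_sphere _ _).prod (isCompact_sphere _ _)
  obtain ⟨⟨w, z⟩, ⟨hw, hz⟩, φ, hφ, hlim⟩ := hcpt.tendsto_subseq (x := fun k => (x k, y k))
    (fun k => by simp [hx, hy])
  simp only [mem_sphere_iff_norm, sub_zero] at hw hz
  have hxw : Tendsto (fun k => x (φ k)) atTop (𝓝 w) := (continuous_fst.tendsto _).comp hlim
  have hyz : Tendsto (fun k => y (φ k)) atTop (𝓝 z) := (continuous_snd.tendsto _).comp hlim
  have hε' := hε.comp hφ.tendsto_atTop
  have hG' : Tendsto (fun k => G (φ k)) atTop (𝓝 G₀) :=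
    tendsto_clm_of_norm_sub_le hε' fun k => hG (φ k)
  have hB' : Tendsto (fun k => B (φ k)) atTop (𝓝 H₀) :=
    tendsto_clm_of_norm_sub_le hε' fun k => hB (φ k)
  have hT_lim : ∀ {a b : ℕ → E} {α β : E}, Tendsto (fun k => a (φ k)) atTop (𝓝 α) →
      Tendsto (fun k => b (φ k)) atTop (𝓝 β) →
      Tendsto (fun k => T (a (φ k)) (a (φ k)) (b (φ k))) atTop (𝓝 (T α α β)) := fun ha hb =>
    tendsto_clm_apply (tendsto_clm_apply ((T.continuous.tendsto _).comp ha) ha) hb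
  have hξ' : Tendsto (fun k => ξ (φ k)) atTop (𝓝 0) :=
    squeeze_zero (fun k => (hξ0 _).le) (fun k => hξ (φ k)) hε'
  have hG_lim : ∀ {a : ℕ → E} {α : E}, Tendsto (fun k => a (φ k)) atTop (𝓝 α) →
      (∀ k, G k (a k) = 0) → G₀ α = 0 := fun ha h0 =>
    tendsto_nhds_unique (tendsto_clm_apply hG' ha) (by simp [h0])
  have hH_lim : ∀ {a b : ℕ → E} {α β : E}, Tendsto (fun k => a (φ k)) atTop (𝓝 α) →
      Tendsto (fun k => b (φ k)) atTop (𝓝 β) →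
      (∀ k, |B k (a k) (b k) + ξ k / 2 * T (a k) (a k) (b k)| ≤ 1 / ((k : ℝ) + 1) * ξ k) →
      H₀ α β = 0 := by
    intro a b α β ha hb h
    have h1 := (tendsto_clm_apply (tendsto_clm_apply hB' ha) hb).add
      ((hξ'.div_const 2).mul (hT_lim ha hb))
    have h2 : H₀ α β + 0 / 2 * T α α β = 0 := tendsto_nhds_unique h1
      (squeeze_zero_norm (fun k => h (φ k))
        (by simpa only [zero_mul, Function.comp_apply] using hε'.mul hξ'))
    simpa using h2
  have hw0 : w ≠ 0 := fun h => by simp [h] at hw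
  have Gw := hG_lim hxw hGx
  have Hww := hH_lim hxw hxw (fun k => hbd k _ (.inl rfl) _ (.inl rfl))
  obtain ⟨s, rfl⟩ := exists_eq_smul_of_isotropic nondeg hw0 Gw (hG_lim hyz hGy) Hww
    (hH_lim hxw hyz (fun k => hbd k _ (.inl rfl) _ (.inr rfl)))
    (hH_lim hyz hxw (fun k => hbd k _ (.inr rfl) _ (.inl rfl)))
    (hH_lim hyz hyz (fun k => hbd k _ (.inr rfl) _ (.inr rfl)))
  have hs : |s| = 1 / 2 := by simpa [norm_smul, hw] using hz
  have hT : T w w (s • w) - T (s • w) (s • w) w = 0 := by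
    refine tendsto_nhds_unique ((hT_lim hxw hyz).sub (hT_lim hyz hxw))
      (squeeze_zero_norm (a := fun k => 4 * (1 / (((φ k : ℕ) : ℝ) + 1))) (fun k => ?_)
        (by simpa using hε'.const_mul 4))
    have h1 := hbd (φ k) _ (.inl rfl) _ (.inr rfl)
    have h2 := hbd (φ k) _ (.inr rfl) _ (.inl rfl)
    have hpos := hξ0 (φ k)
    -- Both bounds now contain the same term of `B`, which drops out of their difference.
    rw [hsymm] at h1
    rw [abs_le] at h1 h2
    simp only [Real.norm_eq_abs, abs_le]
    constructor
    · refine le_of_mul_le_mul_right ?_ hpos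
      linarith
    · refine le_of_mul_le_mul_right ?_ hpos
      linarith
  have hT' : s * (1 - s) * T w w w = 0 := by
    simp only [map_smul, smul_apply, smul_eq_mul] at hT
    linarith
  rcases mul_eq_zero.1 hT' with h | h
  · rcases mul_eq_zero.1 h with h | h
    · norm_num [h] at hs
    · norm_num [show s = 1 by linarith] at hs
  · exact nondeg w hw0 Gw Hww h

end Forms

/-! ### Uniform Taylor estimates for the derivative -/

section Taylor

open Filter Topology

variable {E F : Type*} [NormedAddCommGroup E] [NormedSpace ℝ E] [NormedAddCommGroup F]
  [NormedSpace ℝ F]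

/-- Second order Taylor estimate, uniform in the base point `x`; the quadratic term is frozen
at `x₀`. -/
lemma exists_taylor_two_uniform {f : E → F} {x₀ : E} (hf : ContDiffAt ℝ 2 f x₀) {ε : ℝ}
    (hε : 0 < ε) : ∃ ρ : ℝ, 0 < ρ ∧ ∀ x u : E, ‖x - x₀‖ ≤ ρ → ‖u‖ ≤ ρ →
      ‖f (x + u) - f x - fderiv ℝ f x u - (1 / 2 : ℝ) • fderiv ℝ (fderiv ℝ f) x₀ u u‖
        ≤ ε * ‖u‖ ^ 2 := by
  have h1 : HasStrictFDerivAt (fderiv ℝ f) (fderiv ℝ (fderiv ℝ f) x₀) x₀ :=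
    (hf.fderiv_right (m := 1) (by norm_num)).hasStrictFDerivAt (by norm_num)
  have h2 := (hasStrictFDerivAt_iff_isLittleO.1 h1).def hε
  have h3 : ∀ᶠ p : E × E in 𝓝 (x₀, x₀), DifferentiableAt ℝ f p.1 := by
    have : ∀ᶠ y in 𝓝 x₀, DifferentiableAt ℝ f y :=
      (hf.eventually (by simp)).mono fun y hy => hy.differentiableAt (by norm_num)
    exact (continuous_fst.tendsto (x₀, x₀)).eventually this
  obtain ⟨r, hr, hball⟩ := Metric.eventually_nhds_iff.1 (h2.and h3)
  refine ⟨r / 3, by positivity, fun x u hx hu => ?_⟩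
  have hmem : ∀ t ∈ Set.Icc (0 : ℝ) 1, dist (x + t • u, x) (x₀, x₀) < r := by
    intro t ht
    have h4 : ‖t • u‖ ≤ r / 3 := by
      rw [norm_smul, Real.norm_of_nonneg ht.1]
      nlinarith [norm_nonneg u, ht.2]
    rw [Prod.dist_eq, max_lt_iff, dist_eq_norm, dist_eq_norm]
    refine ⟨?_, by linarith⟩
    calc ‖x + t • u - x₀‖ = ‖(x - x₀) + t • u‖ := by congr 1; abel
      _ ≤ ‖x - x₀‖ + ‖t • u‖ := norm_add_le _ _
      _ < r := by linarith
  set D := fderiv ℝ (fderiv ℝ f) x₀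
  -- The mean value inequality on the segment from `x` to `x + u`.
  have key := norm_image_sub_le_of_norm_deriv_le_segment_01' (C := ε * ‖u‖ ^ 2)
    (f := fun t : ℝ => f (x + t • u) - t • fderiv ℝ f x u - (t ^ 2 / 2) • D u u)
    (f' := fun t : ℝ => fderiv ℝ f (x + t • u) u - fderiv ℝ f x u - t • D u u) ?_ ?_
  · convert key using 2
    simp
    abel
  · intro t ht
    have hl : HasDerivAt (fun t : ℝ => x + t • u) u t := by
      simpa using ((hasDerivAt_id t).smul_const u).const_add x
    have hd := ((hball (hmem t ht)).2.hasFDerivAt.comp_hasDerivAt t hl).sub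
      ((hasDerivAt_id t).smul_const (fderiv ℝ f x u))
    have hq : HasDerivAt (fun t : ℝ => t ^ 2 / 2) t t := by
      simpa using ((hasDerivAt_id t).pow 2).div_const 2
    have hd' := (hd.sub (hq.smul_const (D u u))).hasDerivWithinAt (s := Set.Icc 0 1)
    rw [one_smul] at hd'
    exact hd'
  · intro t ht
    have hb := (hball (hmem t ⟨ht.1, ht.2.le⟩)).1
    simp only [add_sub_cancel_left] at hb
    calc ‖fderiv ℝ f (x + t • u) u - fderiv ℝ f x u - t • D u u‖
        = ‖(fderiv ℝ f (x + t • u) - fderiv ℝ f x - D (t • u)) u‖ := by simp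
      _ ≤ ε * ‖t • u‖ * ‖u‖ := ContinuousLinearMap.le_of_opNorm_le _ hb u
      _ ≤ ε * ‖u‖ ^ 2 := by
        rw [norm_smul, Real.norm_of_nonneg ht.1]
        have : 0 ≤ ε * ‖u‖ ^ 2 := by positivity
        nlinarith [ht.2]

end Taylor

/-! ### Steepness -/

section Steepness

open Filter Topology

lemma iteratedFDeriv_three_apply {E F : Type*} [NormedAddCommGroup E] [NormedSpace ℝ E]
    [NormedAddCommGroup F] [NormedSpace ℝ F] (f : E → F) (x : E) (m : Fin 3 → E) :
    iteratedFDeriv ℝ 3 f x m = fderiv ℝ (fderiv ℝ (fderiv ℝ f)) x (m 0) (m 1) (m 2) := by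
  rw [iteratedFDeriv_succ_apply_right, iteratedFDeriv_two_apply]
  rfl

lemma ThreeJetNondegenerate.fderiv_ne_zero {n : ℕ} {h : EuclideanSpace ℝ (Fin n) → ℝ}
    {I₀ : EuclideanSpace ℝ (Fin n)} (h_jet : ThreeJetNondegenerate h I₀)
    (w : EuclideanSpace ℝ (Fin n)) (hw : w ≠ 0) (h1 : fderiv ℝ h I₀ w = 0)
    (h2 : fderiv ℝ (fderiv ℝ h) I₀ w w = 0) :
    fderiv ℝ (fderiv ℝ (fderiv ℝ h)) I₀ w w w ≠ 0 := by
  intro h3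
  refine h_jet ⟨‖w‖⁻¹ • w, norm_smul_inv_norm hw, ?_, ?_, ?_⟩
  · simp [iteratedFDeriv_one_apply, h1]
  · simp [iteratedFDeriv_two_apply, h2]
  · simp [iteratedFDeriv_three_apply, h3]

lemma eventually_norm_clm_sub_le {X E F : Type*} [TopologicalSpace X] [NormedAddCommGroup E]
    [NormedSpace ℝ E] [NormedAddCommGroup F] [NormedSpace ℝ F] {A : X → E →L[ℝ] F} {x : X}
    (hA : ContinuousAt A x) {ε : ℝ} (hε : 0 < ε) : ∀ᶠ y in 𝓝 x, ‖A y - A x‖ ≤ ε :=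
  (tendsto_iff_norm_sub_tendsto_zero.1 hA).eventually (Iic_mem_nhds hε)

/-- Quadratic steepness in contrapositive form: the projected gradient cannot be small both at a
point of the sphere of radius `ξ` and at a point of the sphere of radius `ξ / 2`. -/
lemma exists_pos_projected_gradient {E : Type*} [NormedAddCommGroup E] [InnerProductSpace ℝ E]
    [FiniteDimensional ℝ E] {h : E → ℝ} {I₀ : E} (hsm : ContDiffAt ℝ 3 h I₀)
    (nondeg : ∀ w, w ≠ 0 → fderiv ℝ h I₀ w = 0 → fderiv ℝ (fderiv ℝ h) I₀ w w = 0 →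
      fderiv ℝ (fderiv ℝ (fderiv ℝ h)) I₀ w w w ≠ 0) :
    ∃ ρ : ℝ, 0 < ρ ∧ ∃ c : ℝ, 0 < c ∧ ∀ I : E, ‖I - I₀‖ < ρ → ∀ Γ : Submodule ℝ E,
      (∀ u ∈ Γ, inner ℝ (gradient h I) u = 0) → ∀ ξ : ℝ, 0 < ξ → ξ ≤ ρ → ∀ u ∈ Γ, ∀ v ∈ Γ,
      ‖u‖ = ξ → ‖v‖ = ξ / 2 → ‖Γ.starProjection (gradient h (I + u))‖ ≤ c * ξ ^ 2 →
      ‖Γ.starProjection (gradient h (I + v))‖ ≤ c * ξ ^ 2 → False := by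
  obtain ⟨ε, hε, hlb⟩ := exists_pos_taylor_lower_bound nondeg
  have hsm1 : ContDiffAt ℝ 2 (fderiv ℝ h) I₀ := hsm.fderiv_right (by norm_num)
  have hsm2 : ContDiffAt ℝ 1 (fderiv ℝ (fderiv ℝ h)) I₀ := hsm1.fderiv_right (by norm_num)
  obtain ⟨ρ₁, hρ₁, htaylor⟩ := exists_taylor_two_uniform hsm1 (half_pos hε)
  have hev1 := eventually_norm_clm_sub_le hsm1.continuousAt hε
  have hev2 := eventually_norm_clm_sub_le hsm2.continuousAt hε
  obtain ⟨ρ₂, hρ₂, hball⟩ := Metric.eventually_nhds_iff.1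
    ((hev1.and hev2).and (hsm.eventually (by simp)))
  refine ⟨min (min ρ₁ ρ₂) ε, by positivity, ε / 2, half_pos hε, ?_⟩
  intro I hI Γ hΓ ξ hξ0 hξ u hu v hv hun hvn hpu hpv
  simp only [lt_min_iff] at hI
  simp only [le_min_iff] at hξ
  obtain ⟨⟨hI1, hI2⟩, hI3⟩ := hball (show dist I I₀ < ρ₂ by rw [dist_eq_norm]; exact hI.1.2)
  have hG0 : ∀ b ∈ Γ, fderiv ℝ h I b = 0 := fun b hb => by
    rw [← inner_gradient_left]
    exact hΓ b hb
  have hproj : ∀ J : E, ∀ b ∈ Γ, ‖b‖ ≤ 1 → ‖Γ.starProjection (gradient h J)‖ ≤ ε / 2 * ξ ^ 2 →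
      |fderiv ℝ h J b| ≤ ε / 2 * ξ ^ 2 := by
    intro J b hb hb1 hJ
    rw [← inner_gradient_left, ← Submodule.starProjection_eq_self_iff.2 hb,
      ← Submodule.inner_starProjection_left_eq_right]
    calc _ ≤ ‖Γ.starProjection (gradient h J)‖ * ‖b‖ := abs_real_inner_le_norm _ _
      _ ≤ ‖Γ.starProjection (gradient h J)‖ * 1 := by gcongr
      _ ≤ _ := by simpa using hJ
  have hxn : ‖ξ⁻¹ • u‖ = 1 := by
    rw [norm_smul, norm_inv, Real.norm_of_nonneg hξ0.le, hun, inv_mul_cancel₀ hξ0.ne']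
  have hyn : ‖ξ⁻¹ • v‖ = 1 / 2 := by
    rw [norm_smul, norm_inv, Real.norm_of_nonneg hξ0.le, hvn]
    field_simp
  have hmem : ∀ a ∈ ({ξ⁻¹ • u, ξ⁻¹ • v} : Set E), a ∈ Γ ∧ ‖a‖ ≤ 1 ∧
      ‖Γ.starProjection (gradient h (I + ξ • a))‖ ≤ ε / 2 * ξ ^ 2 := by
    rintro a (rfl | rfl)
    · exact ⟨Γ.smul_mem _ hu, hxn.le, by rwa [smul_inv_smul₀ hξ0.ne']⟩
    · exact ⟨Γ.smul_mem _ hv, hyn.le.trans (by norm_num), by rwa [smul_inv_smul₀ hξ0.ne']⟩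
  obtain ⟨a, ha, b, hb, hlt⟩ := hlb (fderiv ℝ h I) (fderiv ℝ (fderiv ℝ h) I) ξ (ξ⁻¹ • u) (ξ⁻¹ • v)
    hI1 hI2 hξ0 hξ.2 hxn hyn (hI3.isSymmSndFDerivAt (by norm_num) _ _) (hG0 _ (Γ.smul_mem _ hu))
    (hG0 _ (Γ.smul_mem _ hv))
  refine hlt.not_ge ?_
  obtain ⟨haΓ, ha1, hap⟩ := hmem a ha
  obtain ⟨hbΓ, hb1, -⟩ := hmem b hb
  have hξa : ‖ξ • a‖ ≤ ξ := by
    rw [norm_smul, Real.norm_of_nonneg hξ0.le]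
    nlinarith
  have ht := ContinuousLinearMap.le_of_opNorm_le _
    (htaylor I (ξ • a) hI.1.1.le (hξa.trans hξ.1.1)) b
  have ht' : |fderiv ℝ h (I + ξ • a) b - ξ * (fderiv ℝ (fderiv ℝ h) I a b +
      ξ / 2 * fderiv ℝ (fderiv ℝ (fderiv ℝ h)) I₀ a a b)| ≤ ε / 2 * ξ ^ 2 := by
    calc _ = ‖(fderiv ℝ h (I + ξ • a) - fderiv ℝ h I - fderiv ℝ (fderiv ℝ h) I (ξ • a) -
          (1 / 2 : ℝ) • fderiv ℝ (fderiv ℝ (fderiv ℝ h)) I₀ (ξ • a) (ξ • a)) b‖ := by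
          rw [Real.norm_eq_abs]
          congr 1
          simp [hG0 b hbΓ]
          ring
      _ ≤ ε / 2 * ‖ξ • a‖ ^ 2 * ‖b‖ := ht
      _ ≤ ε / 2 * ξ ^ 2 * 1 := by gcongr
      _ = _ := mul_one _
  have hp := hproj _ b hbΓ hb1 hap
  rw [abs_le] at hp ht' ⊢
  constructor
  · refine le_of_mul_le_mul_left ?_ hξ0
    linarith
  · refine le_of_mul_le_mul_left ?_ hξ0
    linarith

lemma exists_mem_norm_eq {E : Type*} [NormedAddCommGroup E] [NormedSpace ℝ E] (Γ : Submodule ℝ E)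
    (hΓ : 0 < Module.finrank ℝ Γ) {η : ℝ} (hη : 0 ≤ η) : ∃ u ∈ Γ, ‖u‖ = η := by
  have : Nontrivial Γ := Module.nontrivial_of_finrank_pos hΓ
  obtain ⟨u, hu⟩ := exists_norm_eq Γ hη
  exact ⟨u, u.2, hu⟩

variable {n : ℕ} {h : EuclideanSpace ℝ (Fin n) → ℝ} {I : EuclideanSpace ℝ (Fin n)}
  {Γ : Submodule ℝ (EuclideanSpace ℝ (Fin n))}

lemma minProjGrad_le {u : EuclideanSpace ℝ (Fin n)} (hu : u ∈ Γ) :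
    minProjGrad h I Γ ‖u‖ ≤ ‖Γ.starProjection (gradient h (I + u))‖ :=
  csInf_le ⟨0, by rintro _ ⟨v, -, rfl⟩; exact norm_nonneg _⟩ ⟨u, ⟨hu, rfl⟩, rfl⟩

lemma exists_lt_of_minProjGrad_lt (hΓ : 0 < Module.finrank ℝ Γ) {η b : ℝ} (hη : 0 ≤ η)
    (hb : minProjGrad h I Γ η < b) :
    ∃ u ∈ Γ, ‖u‖ = η ∧ ‖Γ.starProjection (gradient h (I + u))‖ < b := by
  obtain ⟨v, hv⟩ := exists_mem_norm_eq Γ hΓ hη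
  obtain ⟨_, ⟨u, ⟨hu, hun⟩, rfl⟩, hub⟩ :=
    exists_lt_of_csInf_lt (Set.Nonempty.image _ ⟨v, hv⟩) hb
  exact ⟨u, hu, hun, hub⟩

/-- The bound `M` on the gradient keeps the supremum from being a junk value. -/
lemma minProjGrad_le_maxMinProjGrad (hΓ : 0 < Module.finrank ℝ Γ) {ξ η M : ℝ}
    (hM : ∀ u, ‖u‖ ≤ ξ → ‖gradient h (I + u)‖ ≤ M) (hη0 : 0 ≤ η) (hη : η ≤ ξ) :
    minProjGrad h I Γ η ≤ maxMinProjGrad h I Γ ξ := by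
  refine le_csSup ⟨M, ?_⟩ ⟨η, ⟨hη0, hη⟩, rfl⟩
  rintro _ ⟨t, ⟨ht0, ht⟩, rfl⟩
  obtain ⟨u, hu, rfl⟩ := exists_mem_norm_eq Γ hΓ ht0
  exact (minProjGrad_le hu).trans ((Γ.norm_starProjection_apply_le _).trans (hM u ht))

end Steepness

theorem corollaryB1 (n : ℕ) (hn : 2 ≤ n) (I₀ : EuclideanSpace ℝ (Fin n))
    (h : EuclideanSpace ℝ (Fin n) → ℝ) (h_smooth : ContDiffAt ℝ 5 h I₀)
    (h_grad : gradient h I₀ ≠ 0) (h_jet : ThreeJetNondegenerate h I₀) :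
    ∃ (R δ : ℝ) (α C : ℕ → ℝ),
      IsSteep h I₀ R α C δ ∧ α 1 = 2 ∧ ∀ m : ℕ, 2 ≤ m → m < n → α m ≤ 3 := by
  obtain ⟨ρ, hρ, c, hc, hkey⟩ := exists_pos_projected_gradient
    (h_smooth.of_le (by norm_num)) h_jet.fderiv_ne_zero
  have hcont : ContinuousAt (gradient h) I₀ :=
    (InnerProductSpace.toDual ℝ (EuclideanSpace ℝ (Fin n))).symm.continuous.continuousAt.comp
      (h_smooth.fderiv_right (m := 4) (by norm_num)).continuousAt
  have hg : 0 < ‖gradient h I₀‖ := norm_pos_iff.2 h_grad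
  have hlow : ∀ᶠ I in nhds I₀, ‖gradient h I₀‖ / 2 < ‖gradient h I‖ :=
    hcont.norm.eventually (lt_mem_nhds (half_lt_self hg))
  have hupp : ∀ᶠ I in nhds I₀, ‖gradient h I‖ < ‖gradient h I₀‖ + 1 :=
    hcont.norm.eventually (gt_mem_nhds (lt_add_one _))
  obtain ⟨r, hr, hball⟩ := Metric.eventually_nhds_iff.1
    ((hlow.and hupp).and (h_smooth.eventually (by simp)))
  -- With `δ = R`, the larger ball has radius `R + 2 * δ = 3 * R ≤ r`.
  set R := min ρ (r / 3)
  have hR0 : 0 < R := by positivity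
  have hRρ : R ≤ ρ := min_le_left _ _
  have hRr : R ≤ r / 3 := min_le_right _ _
  refine ⟨R, R, fun _ => 2, fun _ => c / 2, ?_, rfl, fun _ _ _ => by norm_num⟩
  refine ⟨hR0, hR0, fun _ _ _ => by norm_num, fun _ _ _ => half_pos hc, ?_, ?_, ?_⟩
  · intro I hI
    have hI' : dist I I₀ < r := lt_of_lt_of_le hI (by linarith)
    exact ((hball hI').2.of_le (by norm_num)).contDiffWithinAt
  · refine lt_of_lt_of_le (half_pos hg) (le_csInf ⟨_, I₀, Metric.mem_ball_self hR0, rfl⟩ ?_)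
    rintro _ ⟨I, hI, rfl⟩
    have hI' : dist I I₀ < r := lt_of_lt_of_le hI (by linarith)
    exact (hball hI').1.1.le
  · intro I hI m hm _ Γ hΓ horth ξ hξ0 hξ
    have hpos : 0 < Module.finrank ℝ Γ := by omega
    have hI' : ‖I - I₀‖ < R := by rwa [← dist_eq_norm]
    have hM : ∀ u, ‖u‖ ≤ ξ → ‖gradient h (I + u)‖ ≤ ‖gradient h I₀‖ + 1 := by
      intro u hu
      have hd : dist (I + u) I₀ < r := by
        rw [dist_eq_norm, add_sub_right_comm]
        linarith [norm_add_le (I - I₀) u]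
      exact (hball hd).1.2.le
    by_contra! hle
    have hlt : maxMinProjGrad h I Γ ξ < c * ξ ^ 2 := by
      rw [Real.rpow_two] at hle
      nlinarith [mul_pos hc (pow_pos hξ0 2)]
    obtain ⟨u, hu, hun, hub⟩ := exists_lt_of_minProjGrad_lt hpos hξ0.le
      ((minProjGrad_le_maxMinProjGrad hpos hM hξ0.le le_rfl).trans_lt hlt)
    obtain ⟨v, hv, hvn, hvb⟩ := exists_lt_of_minProjGrad_lt hpos (half_pos hξ0).le
      ((minProjGrad_le_maxMinProjGrad hpos hM (half_pos hξ0).le (half_le_self hξ0.le)).trans_lt hlt)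
    exact hkey I (hI'.trans_le hRρ) Γ horth ξ hξ0 (hξ.trans hRρ) u hu v hv hun hvn hub.le hvb.le
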